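/- **Setting.** Let $d\in\mathbb N$, $T>0$, $S\subseteq\mathbb R^d$. Put $R_i(S)=\sup\{|x_i|:x\in S\}\in[0,\infty]$, and for $\varepsilon>0$ let $P_\varepsilon=\{z\in\mathbb C^d:|z_i|<R_i(S)+\varepsilon \text{ for all } i\}\supseteq S$. Let $\mathcal O(S)$ be the set of functions $f:S\to\mathbb C$ that are the restriction of a holomorphic function on $P_\varepsilon$ for some $\varepsilon>0$. For a complex sequence $\mathbf u=(\mathbf u_\alpha)_{\alpha\in\mathbb N_0^d}$ write $h_{\mathbf u}(z)=\sum_\alpha \mathbf u_\alpha z^\alpha/\alpha!$, and let $\mathcal S^*$ be the set of those $\mathbf u$ for which, for some $\varepsilon>0$, this series converges absolutely on $P_\varepsilon$ to a holomorphic function. For $\mathcal V\subseteq\mathcal O(S)$ let $\mathcal V^*=\{\mathbf u\in\mathcal S^*: h_{\mathbf u}|_S\in\mathcal V\}$. Let $b:S\to\mathbb R^d$ and $a:S\to\mathbb S^d_+$ be measurable and let $K$ be a transition kernel from $S$ to $\mathbb R^d$ with $K(x,\{0\})=0$ and $\int\|\xi\|\wedge\|\xi\|^2K(x,d\xi)<\infty$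 for all $x\in S$. For $x\in S$ put $$\mathcal Af(x)=\nabla f(x)^\top b(x)+\tfrac12\mathrm{Tr}(a(x)\nabla^2f(x))+\int \big(f(x+\xi)-f(x)-\nabla f(x)^\top\xi\big)\,K(x,d\xi),$$ for $f$ in the set $\mathcal D(\mathcal A)$ of $f\in C^2(\mathbb R^d;\mathbb C)$ for which this integrand is $K(x,\cdot)$-integrable for every $x\in S$. A function on $S$ belongs to $\mathcal D(\mathcal A)$ if it has an extension in $\mathcal D(\mathcal A)$, and $\mathcal A$ is then computed from such an extension (any fixed choice of the extensions is allowed). For such $f$ let $$N^f_t=f(X_t)-f(X_0)-\int_0^t\mathcal Af(X_s)\,ds .$$ An $S$-valued adapted càdlàg special semimartingale $X=(X_t)_{t\in[0,T]}$ on a filtered probability space is a jump-diffusion with characteristics $(b,a,K)$ if $N^f$ is (well defined and) a local martingale for every bounded $f\in C^2(\mathbb R^d;\mathbb C)$. It is $\mathcal V$-affine-holomorphic if moreover there is a map $\mathcal R:\mathcal V\to\mathcal O(S)$ such that for every $f\in\mathcal V$: $\exp(f)\in\mathcal D(\mathcal A)$, $\mathcal A\exp(f)=\exp(f)\mathcal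 R(f)$ on $S$, and $N^{\exp(f)}$ is a local martingale. **Theorem.** Let $X$ be an $S$-valued $\mathcal V$-affine-holomorphic process for some $\mathcal V\subseteq\mathcal O(S)$, and let $R:\mathcal V^*\to\mathcal S^*$ be a map such that $\mathcal A\exp(h_{\mathbf v})=\exp(h_{\mathbf v})\,h_{R(\mathbf v)}$ on $S$ for all $\mathbf v\in\mathcal V^*$. Let $X_0=x_0\in S$ almost surely, let $\mathbf u\in\mathcal V^*$, and suppose: 1. the sequence-valued ODE $\psi(t)=\mathbf u+\int_0^tR(\psi(s))\,ds$, $t\in[0,T]$ (integrals taken componentwise), has a $\mathcal V^*$-valued solution $\psi$ such that $h_{\psi(t)}(x)=h_{\mathbf u}(x)+\int_0^th_{R(\psi(s))}(x)\,ds$ for all $x\in S$, $t\in[0,T]$ (all these integrals being absolutely convergent); 2. for each $s\in[0,T]$ the process $N^{\exp(h_{\psi(s)})}$ is a true martingale; 3. $\int_0^T\int_0^T\mathbb E\big[|\mathcal A\exp(h_{\psi(s)})(X_t)|\big]\,ds\,dt<\infty$. Then for Lebesgue-almost every $t\in[0,T]$ the variable $\exp(h_{\mathbf u}(X_t))$ is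 integrable and $$\mathbb E[\exp(h_{\mathbf u}(X_t))]=\exp(h_{\psi(t)}(x_0)).$$ If, moreover, the integrability in 3 also holds on one of the two boundary slices $s=0$ or $t=T$, that is, if $$\int_0^T\mathbb E\big[|\mathcal A\exp(h_{\mathbf u})(X_t)|\big]\,dt<\infty\qquad\text{or}\qquad\int_0^T\mathbb E\big[|\mathcal A\exp(h_{\psi(s)})(X_T)|\big]\,ds<\infty,$$ then $\exp(h_{\mathbf u}(X_T))$ is integrable and $$\mathbb E[\exp(h_{\mathbf u}(X_T))]=\exp(h_{\psi(T)}(x_0)).$$ -/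

import Mathlib

open MeasureTheory ProbabilityTheory Filter Topology
open scoped ENNReal NNReal

namespace AffHol

noncomputable section

/-! ### Power series and holomorphic functions on polydiscs -/

/-- The Euclidean space in which the processes live. -/
abbrev Euc (d : ℕ) : Type := EuclideanSpace ℝ (Fin d)

/-- Complex sequences indexed by multi-indices. -/
abbrev Coeff (d : ℕ) : Type := (Fin d → ℕ) → ℂ

/-- The inclusion of real vectors in complex vectors. -/
def toC {d : ℕ} (x : Euc d) : Fin d → ℂ := fun i => ((x i : ℝ) : ℂ)

/-- The open polydisc centred at the origin with polyradius `R`, whose entries may be infinite. -/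
def polydisc {d : ℕ} (R : Fin d → ℝ≥0∞) : Set (Fin d → ℂ) := {z | ∀ i, ‖z i‖ₑ < R i}

/-- `R_i(S) = sup {|x_i| : x ∈ S}`. -/
def radius {d : ℕ} (S : Set (Euc d)) (i : Fin d) : ℝ≥0∞ := ⨆ x ∈ S, ‖x i‖ₑ

/-- The polydisc of polyradius `R(S) + ε`; it contains `S` if `ε > 0`. -/
def nbhdPolydisc {d : ℕ} (S : Set (Euc d)) (ε : ℝ) : Set (Fin d → ℂ) :=
  polydisc fun i => radius S i + ENNReal.ofReal ε

/-- The term `u_α z^α / α!`. -/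
def term {d : ℕ} (u : Coeff d) (z : Fin d → ℂ) (α : Fin d → ℕ) : ℂ :=
  u α * ((∏ i, z i ^ α i) / ((∏ i, (α i).factorial : ℕ) : ℂ))

/-- The power series `h_u(z) = ∑_α u_α z^α / α!`. -/
def hC {d : ℕ} (u : Coeff d) (z : Fin d → ℂ) : ℂ := ∑' α, term u z α

/-- The restriction of `h_u` to `S`. -/
def hS {d : ℕ} (S : Set (Euc d)) (u : Coeff d) : S → ℂ := fun x => hC u (toC (x : Euc d))

/-- The set `O(S)` of restrictions to `S` of functions that are holomorphic on the polydisc of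
polyradius `R(S) + ε`, for some `ε > 0`. -/
def holoOn {d : ℕ} (S : Set (Euc d)) : Set (S → ℂ) :=
  {f | ∃ ε : ℝ, 0 < ε ∧ ∃ h : (Fin d → ℂ) → ℂ,
    DifferentiableOn ℂ h (nbhdPolydisc S ε) ∧ ∀ x : S, f x = h (toC (x : Euc d))}

/-- The set `S*` of the coefficient sequences whose power series represents a function that is
holomorphic on the polydisc of polyradius `R(S) + ε`, for some `ε > 0`. -/
def coeffOn {d : ℕ} (S : Set (Euc d)) : Set (Coeff d) :=
  {u | ∃ ε : ℝ, 0 < ε ∧ ∃ h : (Fin d → ℂ) → ℂ,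
    DifferentiableOn ℂ h (nbhdPolydisc S ε) ∧ ∀ z ∈ nbhdPolydisc S ε, HasSum (term u z) (h z)}

/-- The set `V*` of the coefficient sequences in `S*` whose power series represents, on `S`, an
element of `V`. -/
def dualSet {d : ℕ} {S : Set (Euc d)} (V : Set (S → ℂ)) : Set (Coeff d) :=
  {u | u ∈ coeffOn S ∧ hS S u ∈ V}

/-- The function `exp ∘ f`. -/
def expFun {X : Type*} (f : X → ℂ) : X → ℂ := fun x => Complex.exp (f x)

/-! ### The extended generator -/

/-- The integrand `f(x + ξ) - f(x) - ∇f(x)ᵀ ξ` of the jump part. -/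
def jumpIncrement {d : ℕ} (F : Euc d → ℂ) (x ξ : Euc d) : ℂ :=
  F (x + ξ) - F x - fderiv ℝ F x ξ

/-- The integro-differential operator with coefficients `(b, a, K)`, applied to a function on the
whole Euclidean space and evaluated on `S`. -/
def genOp {d : ℕ} {S : Set (Euc d)} (b : S → Euc d) (a : S → Matrix (Fin d) (Fin d) ℝ)
    (K : Kernel S (Euc d)) (F : Euc d → ℂ) (x : S) : ℂ :=
  fderiv ℝ F x (b x)
    + (1 / 2) * ∑ i, ∑ j, (a x i j : ℂ) *
        fderiv ℝ (fderiv ℝ F) x (EuclideanSpace.single j 1) (EuclideanSpace.single i 1)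
    + ∫ ξ, jumpIncrement F x ξ ∂(K x)

/-- The domain `D(A)`: the complex `C²` functions with integrable jump part at each point
of `S`. -/
def genDomain {d : ℕ} {S : Set (Euc d)} (K : Kernel S (Euc d)) : Set (Euc d → ℂ) :=
  {F | ContDiff ℝ 2 F ∧ ∀ x : S, Integrable (jumpIncrement F x) (K x)}

/-- The functions on `S` that belong to `D(A)`, which means that they are the restriction to `S`
of an element of `D(A)`. -/
def genDomainOn {d : ℕ} {S : Set (Euc d)} (K : Kernel S (Euc d)) : Set (S → ℂ) :=
  {f | ∃ F ∈ genDomain K, ∀ x : S, F x = f x}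

/-- `A` is the extended generator with coefficients `(b, a, K)`, as an operator on functions
on `S`: for every `f` on `S` that belongs to the domain, `A f` is computed from an extension of `f`
in the domain. (If the value does not depend on the extension, then `A` is unique on the domain;
otherwise every choice of the extensions is allowed.) -/
def IsExtendedGenerator {d : ℕ} {S : Set (Euc d)} (b : S → Euc d)
    (a : S → Matrix (Fin d) (Fin d) ℝ) (K : Kernel S (Euc d)) (A : (S → ℂ) → (S → ℂ)) : Prop :=
  ∀ f ∈ genDomainOn K, ∃ F ∈ genDomain K, (∀ x : S, F x = f x) ∧ A f = genOp b a K F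

/-! ### Processes on `[0, T]` -/

/-- The time interval `[0, T]`. -/
abbrev Time (T : ℝ) : Type := Set.Icc (0 : ℝ) T

/-- Lebesgue measure on `[0, T]`. -/
def leb (T : ℝ) : Measure (Time T) := Measure.comap Subtype.val volume

instance factLe {T : ℝ} [h : Fact (0 < T)] : Fact ((0 : ℝ) ≤ T) := ⟨h.out.le⟩

/-- Right-continuous paths with left limits. -/
def IsCadlagPath {T : ℝ} {E : Type*} [TopologicalSpace E] (y : Time T → E) : Prop :=
  ∀ t, ContinuousWithinAt y (Set.Ioi t) t ∧ ∃ l, Tendsto y (𝓝[<] t) (𝓝 l)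

section Processes

variable {T : ℝ} [Fact (0 < T)] {Ω : Type*} {mΩ : MeasurableSpace Ω}

/-- Local martingales on `[0, T]`. The stopping times take values in `[0, T] ∪ {⊤}`, and a
localizing sequence is eventually equal to `⊤`, almost surely. -/
def IsLocalMart {E : Type*} [NormedAddCommGroup E] [NormedSpace ℝ E] [CompleteSpace E]
    (𝓕 : Filtration (Time T) mΩ) (P : Measure Ω) (N : Time T → Ω → E) : Prop :=
  Locally (fun M => Martingale M 𝓕 P) 𝓕 N P

/-- Special semimartingales: the sum of the initial value, of a càdlàg local martingale and of a
predictable càdlàg process of finite variation, both null at time zero. -/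
def IsSpecialSemimartingale {d : ℕ} (𝓕 : Filtration (Time T) mΩ) (P : Measure Ω)
    (X : Time T → Ω → Euc d) : Prop :=
  ∃ M B : Time T → Ω → Euc d,
    IsLocalMart 𝓕 P M ∧ IsStronglyPredictable 𝓕 B ∧
    ∀ᵐ ω ∂P, IsCadlagPath (fun t => M t ω) ∧ IsCadlagPath (fun t => B t ω) ∧
      BoundedVariationOn (fun t => B t ω) Set.univ ∧ M ⊥ ω = 0 ∧ B ⊥ ω = 0 ∧
      ∀ t, X t ω = X ⊥ ω + M t ω + B t ω

/-- The process `f(X_t) - f(X_0) - ∫_0^t g(X_s) ds`. With `g = A f` it is the process `N^f`. -/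
def dynkin {S : Type*} (X : Time T → Ω → S) (f g : S → ℂ) (t : Time T) (ω : Ω) : ℂ :=
  f (X t ω) - f (X ⊥ ω) - ∫ s in Set.Iic t, g (X s ω) ∂(leb T)

/-- The time integral in `dynkin X f g` exists almost surely. -/
def DynkinDefined {S : Type*} (P : Measure Ω) (X : Time T → Ω → S) (g : S → ℂ) : Prop :=
  ∀ᵐ ω ∂P, Integrable (fun s => g (X s ω)) (leb T)

/-- `f(X_t) - f(X_0) - ∫_0^t g(X_s) ds` is well defined and a local martingale. -/
def DynkinLocalMart {S : Type*} (𝓕 : Filtration (Time T) mΩ) (P : Measure Ω)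
    (X : Time T → Ω → S) (f g : S → ℂ) : Prop :=
  DynkinDefined P X g ∧ IsLocalMart 𝓕 P (dynkin X f g)

/-- `f(X_t) - f(X_0) - ∫_0^t g(X_s) ds` is well defined and a (true) martingale. -/
def DynkinMart {S : Type*} (𝓕 : Filtration (Time T) mΩ) (P : Measure Ω)
    (X : Time T → Ω → S) (f g : S → ℂ) : Prop :=
  DynkinDefined P X g ∧ Martingale (dynkin X f g) 𝓕 P

/-- `S`-valued jump-diffusions on `[0, T]` with characteristics `(b, a, K)`. -/
structure IsJumpDiffusion {d : ℕ} {S : Set (Euc d)} (b : S → Euc d)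
    (a : S → Matrix (Fin d) (Fin d) ℝ) (K : Kernel S (Euc d))
    (𝓕 : Filtration (Time T) mΩ) (P : Measure Ω) (X : Time T → Ω → S) : Prop where
  measurable_drift : Measurable b
  measurable_diffusion : ∀ i j, Measurable fun x => a x i j
  posSemidef : ∀ x, (a x).PosSemidef
  kernel_zero : ∀ x, K x {0} = 0
  kernel_integrable : ∀ x, ∫⁻ ξ, min ‖ξ‖ₑ (‖ξ‖ₑ ^ 2) ∂(K x) < ∞
  adapted : ∀ t, Measurable[𝓕 t] (X t)
  cadlag : ∀ ω, IsCadlagPath fun t => (X t ω : Euc d)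
  special : IsSpecialSemimartingale 𝓕 P fun t ω => (X t ω : Euc d)
  martingale_problem : ∀ F : Euc d → ℂ, ContDiff ℝ 2 F → (∃ C : ℝ, ∀ x, ‖F x‖ ≤ C) →
    DynkinLocalMart 𝓕 P X (fun x => F x) (genOp b a K F)

/-- `S`-valued `V`-affine-holomorphic processes with characteristics `(b, a, K)` and extended
generator `A`. -/
structure IsAffineHolomorphic {d : ℕ} {S : Set (Euc d)} (b : S → Euc d)
    (a : S → Matrix (Fin d) (Fin d) ℝ) (K : Kernel S (Euc d)) (A : (S → ℂ) → (S → ℂ))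
    (V : Set (S → ℂ)) (𝓕 : Filtration (Time T) mΩ) (P : Measure Ω) (X : Time T → Ω → S) :
    Prop where
  jumpDiffusion : IsJumpDiffusion b a K 𝓕 P X
  generator : IsExtendedGenerator b a K A
  subset : V ⊆ holoOn S
  affine : ∃ R : (S → ℂ) → (S → ℂ), ∀ f ∈ V, R f ∈ holoOn S ∧
    expFun f ∈ genDomainOn K ∧ A (expFun f) = expFun f * R f ∧
    DynkinLocalMart 𝓕 P X (expFun f) (A (expFun f))

end Processes

/-- `ψ` is a `V*`-valued solution on `[0, T]` of `ψ(t) = u + ∫_0^t R(ψ(s)) ds`, where the integral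
is taken componentwise, and the equation also holds for the represented functions, pointwise
on `S`. -/
structure IsRiccatiSolution {d : ℕ} {S : Set (Euc d)} (V : Set (S → ℂ)) (R : Coeff d → Coeff d)
    (T : ℝ) (u : Coeff d) (ψ : ℝ → Coeff d) : Prop where
  mem : ∀ t ∈ Set.Icc (0 : ℝ) T, ψ t ∈ dualSet V
  integrable_coeff : ∀ α, IntervalIntegrable (fun s => R (ψ s) α) volume 0 T
  eq_coeff : ∀ t ∈ Set.Icc (0 : ℝ) T, ∀ α, ψ t α = u α + ∫ s in (0 : ℝ)..t, R (ψ s) α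
  integrable_point : ∀ x : S, IntervalIntegrable (fun s => hS S (R (ψ s)) x) volume 0 T
  eq_point : ∀ t ∈ Set.Icc (0 : ℝ) T, ∀ x : S,
    hS S (ψ t) x = hS S u x + ∫ s in (0 : ℝ)..t, hS S (R (ψ s)) x

end

end AffHol

/-!
The proof is a duality argument. Write `g s = exp (h_{ψ(s)})` and `f s t = E[g s (X_t)]`. By the
Riccati equation and the chain rule along absolutely continuous paths (`exp_eq_add_integral`),
`∂_s g s = g s * h_{R(ψ(s))} = A (g s)` on `S`. By the martingale property, Dynkin's formula gives
`∂_t f s t = E[A (g s) (X_t)]`. Hence `f` has the same partial derivative `φ s t = E[A (g s) (X_t)]`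
in both variables, and should be a function of `s + t`; then `f 0 t = f t 0`, which is the claim, as
`f 0 t = E[exp (h_u (X_t))]` and `f t 0 = exp (h_{ψ(t)}(x₀))`.

Under the integrability assumption, both equations hold in integrated form only, the one in `s` for
almost every `t` and the one in `t` for almost every `s`. Comparing the integrals of `f` over the two
axes with its integral over the antidiagonal `s + t = τ`, for every `τ`, yields `f 0 t = f t 0` for
almost every `t` (`ae_eq_axes`). If the slice `s = 0` is regular, then both sides are continuous
in `t`, and `t = T` follows. If the slice `t = T` is regular, then `f 0 T` and `f T 0` are connected
through a point of the antidiagonal `s + t = T` on a regular line `s = σ` (`eq_corner`).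

The hypotheses are iterated lower integrals without any joint measurability, which has to be
supplied before Tonelli's theorem applies. The process is jointly measurable, as its paths are
right-continuous (`measurable_uncurry_of_rightContinuous`), and `A (g s)` has a version that is
jointly measurable in time and space, since power series are limits of polynomials and the
coefficients of `R (ψ s)` can be redefined on a null set of times
(`IsRiccatiSolution.exists_measurable_generator`).
-/

namespace AffHol

/-! ### Absolutely continuous paths -/

theorem absolutelyContinuousOnInterval_of_dist_le {E : Type*} [PseudoMetricSpace E]
    {f : ℝ → E} {g : ℝ → ℝ} {a b C : ℝ} (hg : AbsolutelyContinuousOnInterval g a b)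
    (h : ∀ x ∈ Set.uIcc a b, ∀ y ∈ Set.uIcc a b, dist (f x) (f y) ≤ C * dist (g x) (g y)) :
    AbsolutelyContinuousOnInterval f a b := by
  have hC : Tendsto (fun I : ℕ × (ℕ → ℝ × ℝ) =>
      C * ∑ i ∈ Finset.range I.1, dist (g (I.2 i).1) (g (I.2 i).2))
      (AbsolutelyContinuousOnInterval.totalLengthFilter ⊓
        𝓟 (AbsolutelyContinuousOnInterval.disjWithin a b)) (𝓝 0) := by
    simpa using Tendsto.const_mul C hg
  refine squeeze_zero' (Eventually.of_forall fun I => Finset.sum_nonneg fun i _ => dist_nonneg)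
    ?_ hC
  filter_upwards [mem_inf_of_right (mem_principal_self _)] with I hI
  rw [Finset.mul_sum]
  exact Finset.sum_le_sum fun i hi => h _ (hI.1 i hi).1 _ (hI.1 i hi).2

/-- The chain rule for the exponential along an absolutely continuous path, in integrated form. -/
theorem exp_eq_add_integral {h H : ℝ → ℂ} {a b : ℝ} (hab : a ≤ b)
    (hint : IntervalIntegrable h volume a b)
    (hH : ∀ s ∈ Set.Icc a b, H s = H a + ∫ r in a..s, h r) :
    IntervalIntegrable (fun r => Complex.exp (H r) * h r) volume a b ∧
    ∀ s ∈ Set.Icc a b, Complex.exp (H s) =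
      Complex.exp (H a) + ∫ r in a..s, Complex.exp (H r) * h r := by
  have hsub : ∀ x ∈ Set.Icc a b, ∀ y ∈ Set.Icc a b, IntervalIntegrable h volume x y :=
    fun x hx y hy => hint.mono_set (by
      rw [Set.uIcc_of_le hab]; exact Set.uIcc_subset_Icc hx hy)
  have hHc : ContinuousOn H (Set.Icc a b) := by
    have h1 : ContinuousOn (fun s => H a + ∫ r in a..s, h r) (Set.Icc a b) :=
      continuousOn_const.add (by
        have := intervalIntegral.continuousOn_primitive_interval
          ((intervalIntegrable_iff_integrableOn_Icc_of_le hab).1 hint |>.mono_set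
            (Set.uIcc_of_le hab).subset)
        rwa [Set.uIcc_of_le hab] at this)
    exact h1.congr hH
  have hec : ContinuousOn (fun s => Complex.exp (H s)) (Set.Icc a b) :=
    Complex.continuous_exp.comp_continuousOn hHc
  have hei : IntervalIntegrable (fun r => Complex.exp (H r) * h r) volume a b :=
    hint.continuousOn_mul (by rwa [Set.uIcc_of_le hab])
  refine ⟨hei, ?_⟩
  have hesub : ∀ x ∈ Set.Icc a b, ∀ y ∈ Set.Icc a b,
      IntervalIntegrable (fun r => Complex.exp (H r) * h r) volume x y :=
    fun x hx y hy => hei.mono_set (by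
      rw [Set.uIcc_of_le hab]; exact Set.uIcc_subset_Icc hx hy)
  have haI : a ∈ Set.Icc a b := Set.left_mem_Icc.2 hab
  obtain ⟨M, hM⟩ := isCompact_Icc.exists_bound_of_continuousOn hHc
  have hexp : ∀ z : ℂ, ‖z‖ ≤ M → ‖Complex.exp z‖ ≤ Real.exp M := fun z hz => by
    rw [Complex.norm_exp]; exact Real.exp_le_exp.2 ((Complex.re_le_norm z).trans hz)
  have hlip : ∀ z w : ℂ, ‖z‖ ≤ M → ‖w‖ ≤ M →
      ‖Complex.exp z - Complex.exp w‖ ≤ Real.exp M * ‖z - w‖ := fun z w hz hw =>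
    (convex_closedBall (0 : ℂ) M).norm_image_sub_le_of_norm_deriv_le
      (fun x _ => Complex.differentiableAt_exp)
      (fun x hx => by rw [Complex.deriv_exp]; exact hexp x (by simpa using hx))
      (by simpa using hw) (by simpa using hz)
  set F : ℝ → ℂ := fun s => Complex.exp (H s) - ∫ r in a..s, Complex.exp (H r) * h r with hF
  set N : ℝ → ℝ := fun s => ∫ r in a..s, ‖h r‖ with hN
  have hNac : AbsolutelyContinuousOnInterval N a b :=
    hint.norm.absolutelyContinuousOnInterval_intervalIntegral (by simp)
  -- `F` inherits absolute continuity from `N`; its derivative vanishes almost everywhere.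
  have hle : ∀ x ∈ Set.Icc a b, ∀ y ∈ Set.Icc a b, x ≤ y →
      dist (F y) (F x) ≤ (2 * Real.exp M) * dist (N y) (N x) := by
    intro x hx y hy hxy
    have hnn : 0 ≤ ∫ r in x..y, ‖h r‖ :=
      intervalIntegral.integral_nonneg hxy fun _ _ => norm_nonneg _
    have e1 : N y - N x = ∫ r in x..y, ‖h r‖ :=
      intervalIntegral.integral_interval_sub_left (hsub a haI y hy).norm (hsub a haI x hx).norm
    have e2 : H y - H x = ∫ r in x..y, h r := by
      rw [hH y hy, hH x hx, add_sub_add_left_eq_sub]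
      exact intervalIntegral.integral_interval_sub_left (hsub a haI y hy) (hsub a haI x hx)
    have e3 : F y - F x = (Complex.exp (H y) - Complex.exp (H x)) -
        ∫ r in x..y, Complex.exp (H r) * h r := by
      rw [← intervalIntegral.integral_interval_sub_left (hesub a haI y hy) (hesub a haI x hx)]
      simp only [hF]; ring
    have b1 : ‖H y - H x‖ ≤ ∫ r in x..y, ‖h r‖ := by
      rw [e2]; exact intervalIntegral.norm_integral_le_integral_norm hxy
    have b2 : ‖∫ r in x..y, Complex.exp (H r) * h r‖ ≤ Real.exp M * ∫ r in x..y, ‖h r‖ := by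
      rw [← intervalIntegral.integral_const_mul]
      refine intervalIntegral.norm_integral_le_of_norm_le hxy (ae_of_all _ fun r hr => ?_)
        ((hsub x hx y hy).norm.const_mul _)
      rw [norm_mul]
      exact mul_le_mul_of_nonneg_right
        (hexp _ (hM r ⟨hx.1.trans hr.1.le, hr.2.trans hy.2⟩)) (norm_nonneg _)
    rw [dist_eq_norm, Real.dist_eq, e1, abs_of_nonneg hnn, e3]
    calc _ ≤ ‖Complex.exp (H y) - Complex.exp (H x)‖ + _ := norm_sub_le _ _
      _ ≤ Real.exp M * (∫ r in x..y, ‖h r‖) + Real.exp M * ∫ r in x..y, ‖h r‖ :=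
        add_le_add ((hlip _ _ (hM y hy) (hM x hx)).trans
          (mul_le_mul_of_nonneg_left b1 (Real.exp_pos _).le)) b2
      _ = _ := by ring
  have hFac : AbsolutelyContinuousOnInterval F a b := by
    refine absolutelyContinuousOnInterval_of_dist_le (C := 2 * Real.exp M) hNac ?_
    rw [Set.uIcc_of_le hab]
    intro x hx y hy
    rcases le_total x y with hxy | hxy
    · rw [dist_comm (F x), dist_comm (N x)]; exact hle x hx y hy hxy
    · exact hle y hy x hx hxy
  have hder : ∀ᵐ x, x ∈ Set.uIcc a b → HasDerivAt F 0 x := by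
    have hne : ∀ c : ℝ, ∀ᵐ x : ℝ, x ≠ c := fun c => by simp [ae_iff, measure_singleton]
    filter_upwards [hint.ae_hasDerivAt_integral, hei.ae_hasDerivAt_integral, hne a, hne b]
      with x h1 h2 hxa hxb hx
    have hx' : x ∈ Set.Icc a b := by rwa [Set.uIcc_of_le hab] at hx
    have hnhds : Set.Icc a b ∈ 𝓝 x :=
      Icc_mem_nhds (lt_of_le_of_ne hx'.1 (Ne.symm hxa)) (lt_of_le_of_ne hx'.2 hxb)
    have d1 : HasDerivAt H (h x) x :=
      ((h1 hx a (by simp)).const_add (H a)).congr_of_eventuallyEq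
        (by filter_upwards [hnhds] with s hs using hH s hs)
    have d2 := d1.cexp.sub (h2 hx a (by simp))
    rw [sub_self] at d2
    exact d2
  obtain ⟨C, hC⟩ := hFac.const_of_ae_hasDerivAt_zero hder
  rw [Set.uIcc_of_le hab] at hC
  intro s hs
  have h1 := hC s hs
  have h2 := hC a haI
  simp only [hF, intervalIntegral.integral_same, sub_zero] at h1 h2
  rw [h2, ← h1]; ring

/-! ### Functions with equal partial derivatives -/

/-- Fubini on a right triangle with legs on the axes. -/
theorem integral_triangle_swap {φ : ℝ → ℝ → ℂ}
    (hφ : Integrable (Function.uncurry φ) (volume.prod volume)) {τ : ℝ} (hτ : 0 ≤ τ) :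
    IntervalIntegrable (fun s => ∫ r in (0 : ℝ)..(τ - s), φ s r) volume 0 τ ∧
    IntervalIntegrable (fun t => ∫ r in (0 : ℝ)..(τ - t), φ r t) volume 0 τ ∧
    ∫ s in (0 : ℝ)..τ, ∫ r in (0 : ℝ)..(τ - s), φ s r =
      ∫ t in (0 : ℝ)..τ, ∫ r in (0 : ℝ)..(τ - t), φ r t := by
  set D : Set (ℝ × ℝ) := {p | 0 < p.1 ∧ 0 < p.2 ∧ p.1 + p.2 ≤ τ} with hD
  have hDm : MeasurableSet D := by
    refine (measurableSet_lt measurable_const measurable_fst).inter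
      ((measurableSet_lt measurable_const measurable_snd).inter
        (measurableSet_le (measurable_fst.add measurable_snd) measurable_const))
  have hI : Integrable (D.indicator (Function.uncurry φ)) (volume.prod volume) :=
    hφ.indicator hDm
  have e1 : ∀ s : ℝ, (Set.Ioc 0 τ).indicator (fun s => ∫ r in (0 : ℝ)..(τ - s), φ s r) s =
      ∫ r, D.indicator (Function.uncurry φ) (s, r) := by
    intro s
    by_cases hs : s ∈ Set.Ioc 0 τ
    · rw [Set.indicator_of_mem hs, intervalIntegral.integral_of_le (by linarith [hs.2]),
        ← integral_indicator measurableSet_Ioc]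
      refine integral_congr_ae (ae_of_all _ fun r => ?_)
      simp only [Set.indicator, hD, Set.mem_Ioc, Set.mem_ofPred_eq, Function.uncurry]
      refine if_congr ⟨fun h => ⟨hs.1, h.1, by linarith [h.2]⟩, fun h => ⟨h.2.1, by linarith [h.2.2]⟩⟩ rfl rfl
    · rw [Set.indicator_of_notMem hs]
      symm
      refine integral_eq_zero_of_ae (ae_of_all _ fun r => Set.indicator_of_notMem (fun h => hs ?_) _)
      exact ⟨h.1, by have := h.2.1; have := h.2.2; simp only at *; linarith⟩
  have e2 : ∀ t : ℝ, (Set.Ioc 0 τ).indicator (fun t => ∫ r in (0 : ℝ)..(τ - t), φ r t) t =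
      ∫ r, D.indicator (Function.uncurry φ) (r, t) := by
    intro s
    by_cases hs : s ∈ Set.Ioc 0 τ
    · rw [Set.indicator_of_mem hs, intervalIntegral.integral_of_le (by linarith [hs.2]),
        ← integral_indicator measurableSet_Ioc]
      refine integral_congr_ae (ae_of_all _ fun r => ?_)
      simp only [Set.indicator, hD, Set.mem_Ioc, Set.mem_ofPred_eq, Function.uncurry]
      refine if_congr ⟨fun h => ⟨h.1, hs.1, by linarith [h.2]⟩, fun h => ⟨h.1, by linarith [h.2.2]⟩⟩ rfl rfl
    · rw [Set.indicator_of_notMem hs]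
      symm
      refine integral_eq_zero_of_ae (ae_of_all _ fun r => Set.indicator_of_notMem (fun h => hs ?_) _)
      exact ⟨h.2.1, by have := h.1; have := h.2.2; simp only at *; linarith⟩
  have i1 := hI.integral_prod_left
  have i2 := hI.integral_prod_right
  simp only [← e1] at i1
  simp only [← e2] at i2
  refine ⟨?_, ?_, ?_⟩
  · rw [intervalIntegrable_iff_integrableOn_Ioc_of_le hτ]
    exact (integrable_indicator_iff measurableSet_Ioc).1 i1
  · rw [intervalIntegrable_iff_integrableOn_Ioc_of_le hτ]
    exact (integrable_indicator_iff measurableSet_Ioc).1 i2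
  · rw [intervalIntegral.integral_of_le hτ, intervalIntegral.integral_of_le hτ,
      ← integral_indicator measurableSet_Ioc, ← integral_indicator measurableSet_Ioc]
    simp only [e1, e2]
    exact integral_integral_swap hI

theorem ae_eq_zero_of_forall_integral_eq_zero {k : ℝ → ℂ} {L : ℝ} (hL : 0 ≤ L)
    (hk : IntervalIntegrable k volume 0 L) (h : ∀ τ ∈ Set.Icc 0 L, ∫ t in (0 : ℝ)..τ, k t = 0) :
    ∀ᵐ t, t ∈ Set.Icc 0 L → k t = 0 := by
  have hne : ∀ c : ℝ, ∀ᵐ x : ℝ, x ≠ c := fun c => by simp [ae_iff, measure_singleton]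
  filter_upwards [hk.ae_hasDerivAt_integral, hne 0, hne L] with x h1 hx0 hxL hx
  have h2 := h1 (by rwa [Set.uIcc_of_le hL]) 0 (by simp)
  have hnhds : Set.Icc 0 L ∈ 𝓝 x :=
    Icc_mem_nhds (lt_of_le_of_ne hx.1 (Ne.symm hx0)) (lt_of_le_of_ne hx.2 hxL)
  have h3 : HasDerivAt (fun x => ∫ t in (0 : ℝ)..x, k t) 0 x :=
    (hasDerivAt_const x (0 : ℂ)).congr_of_eventuallyEq
      (by filter_upwards [hnhds] with s hs using h s hs)
  exact h2.unique h3

/-- A function of two variables with the same partial derivative `φ` in both variables, in the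
integrated sense and along almost every line only, takes almost everywhere equal values on the two
axes. Both sides are compared with the integral of `f` over the antidiagonal `s + t = τ`. -/
theorem ae_eq_axes {f φ : ℝ → ℝ → ℂ} {L : ℝ} (hL : 0 ≤ L)
    (hφ : Integrable (Function.uncurry φ) (volume.prod volume))
    (hV : ∀ᵐ s, s ∈ Set.Icc 0 L → ∀ t ∈ Set.Icc 0 L, f s t = f s 0 + ∫ r in (0 : ℝ)..t, φ s r)
    (hH : ∀ᵐ t, t ∈ Set.Icc 0 L → ∀ s ∈ Set.Icc 0 L, f s t = f 0 t + ∫ r in (0 : ℝ)..s, φ r t)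
    (h0 : IntervalIntegrable (fun s => f s 0) volume 0 L) :
    ∀ᵐ t, t ∈ Set.Icc 0 L → f 0 t = f t 0 := by
  have key : ∀ τ ∈ Set.Icc 0 L, IntervalIntegrable (fun t => f 0 t) volume 0 τ ∧
      ∫ t in (0 : ℝ)..τ, f 0 t = ∫ s in (0 : ℝ)..τ, f s 0 := by
    intro τ hτ
    obtain ⟨i1, i2, e⟩ := integral_triangle_swap hφ hτ.1
    have h0τ : IntervalIntegrable (fun s => f s 0) volume 0 τ := h0.mono_set (by
      rw [Set.uIcc_of_le hL, Set.uIcc_of_le hτ.1]; exact Set.Icc_subset_Icc_right hτ.2)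
    have c1 : ∀ᵐ s, s ∈ Set.uIoc 0 τ →
        f s 0 + (∫ r in (0 : ℝ)..(τ - s), φ s r) = f s (τ - s) := by
      filter_upwards [hV] with s hs hmem
      rw [Set.uIoc_of_le hτ.1] at hmem
      exact (hs ⟨hmem.1.le, hmem.2.trans hτ.2⟩ (τ - s)
        ⟨by linarith [hmem.2], by linarith [hmem.1, hτ.2]⟩).symm
    have c2 : ∀ᵐ t, t ∈ Set.uIoc 0 τ →
        f (τ - t) t - (∫ r in (0 : ℝ)..(τ - t), φ r t) = f 0 t := by
      filter_upwards [hH] with s hs hmem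
      rw [Set.uIoc_of_le hτ.1] at hmem
      rw [hs ⟨hmem.1.le, hmem.2.trans hτ.2⟩ (τ - s)
        ⟨by linarith [hmem.2], by linarith [hmem.1, hτ.2]⟩]
      ring
    have j1 : IntervalIntegrable (fun s => f s (τ - s)) volume 0 τ :=
      (h0τ.add i1).congr_ae ((ae_restrict_iff' measurableSet_uIoc).2 c1)
    have j2 : IntervalIntegrable (fun t => f (τ - t) t) volume 0 τ := by
      have := (j1.comp_sub_left τ).symm
      simpa using this
    refine ⟨(j2.sub i2).congr_ae ((ae_restrict_iff' measurableSet_uIoc).2 c2), ?_⟩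
    rw [← intervalIntegral.integral_congr_ae c2, intervalIntegral.integral_sub j2 i2, ← e]
    have e3 : ∫ t in (0 : ℝ)..τ, f (τ - t) t = ∫ s in (0 : ℝ)..τ, f s (τ - s) := by
      have := intervalIntegral.integral_comp_sub_left (a := 0) (b := τ)
        (fun s => f s (τ - s)) τ
      simpa using this
    rw [e3, ← intervalIntegral.integral_congr_ae c1, intervalIntegral.integral_add h0τ i1]
    ring
  have hi := (key L (Set.right_mem_Icc.2 hL)).1
  have := ae_eq_zero_of_forall_integral_eq_zero hL (hi.sub h0) (fun τ hτ => by
    rw [intervalIntegral.integral_sub (key τ hτ).1 (h0.mono_set (by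
      rw [Set.uIcc_of_le hL, Set.uIcc_of_le hτ.1]; exact Set.Icc_subset_Icc_right hτ.2)),
      (key τ hτ).2, sub_self])
  filter_upwards [this] with t ht hm
  exact sub_eq_zero.1 (ht hm)

theorem continuousOn_of_eq_add_integral {f k : ℝ → ℂ} {c : ℂ} {T : ℝ} (hT : 0 ≤ T)
    (hk : IntervalIntegrable k volume 0 T)
    (h : ∀ t ∈ Set.Icc 0 T, f t = c + ∫ r in (0 : ℝ)..t, k r) : ContinuousOn f (Set.Icc 0 T) := by
  have h1 := intervalIntegral.continuousOn_primitive_interval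
    ((intervalIntegrable_iff_integrableOn_Icc_of_le hT).1 hk |>.mono_set
      (Set.uIcc_of_le hT).subset)
  rw [Set.uIcc_of_le hT] at h1
  exact (continuousOn_const.add h1).congr h

theorem eqOn_Icc_of_ae_eq {f g : ℝ → ℂ} {T : ℝ} (hT : 0 < T) (hf : ContinuousOn f (Set.Icc 0 T))
    (hg : ContinuousOn g (Set.Icc 0 T)) (h : ∀ᵐ t, t ∈ Set.Icc 0 T → f t = g t) :
    Set.EqOn f g (Set.Icc 0 T) :=
  Measure.eqOn_Icc_of_ae_eq volume hT.ne ((ae_restrict_iff' measurableSet_Icc).2 h) hf hg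

/-- The corner case of `ae_eq_axes`: the endpoint value, if the line `t = T` is a regular one. An
interior regular line `s = σ` is crossed: `f 0 T = f σ (T - σ)` follows from `ae_eq_axes` in the
square with opposite corners `(σ, T)` and `(0, T - σ)`, reflected at its centre, and
`f σ (T - σ) = f T 0` from `ae_eq_axes` in the square with lower left corner `(σ, 0)`. -/
theorem eq_corner {f φ : ℝ → ℝ → ℂ} {T : ℝ} (hT : 0 < T)
    (hφ : Integrable (Function.uncurry φ) (volume.prod volume))
    (hV : ∀ᵐ s, s ∈ Set.Icc 0 T → ∀ t ∈ Set.Icc 0 T, f s t = f s 0 + ∫ r in (0 : ℝ)..t, φ s r)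
    (hH : ∀ᵐ t, t ∈ Set.Icc 0 T → ∀ s ∈ Set.Icc 0 T, f s t = f 0 t + ∫ r in (0 : ℝ)..s, φ r t)
    (h0 : ContinuousOn (fun s => f s 0) (Set.Icc 0 T))
    (hTi : IntervalIntegrable (fun r => φ r T) volume 0 T)
    (hTH : ∀ s ∈ Set.Icc 0 T, f s T = f 0 T + ∫ r in (0 : ℝ)..s, φ r T) :
    f 0 T = f T 0 := by
  obtain ⟨σ, ⟨hσ0, hσT⟩, hσV, hσi⟩ : ∃ σ ∈ Set.Ioo 0 T,
      (∀ t ∈ Set.Icc 0 T, f σ t = f σ 0 + ∫ r in (0 : ℝ)..t, φ σ r) ∧ Integrable (φ σ) volume := by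
    have h1 : ∀ᵐ s, (s ∈ Set.Icc 0 T → ∀ t ∈ Set.Icc 0 T,
        f s t = f s 0 + ∫ r in (0 : ℝ)..t, φ s r) ∧ Integrable (φ s) volume :=
      hV.and hφ.prod_right_ae
    have h2 : (Set.Ioo 0 T) ∈ ae (volume.restrict (Set.Ioo 0 T)) := self_mem_ae_restrict
      measurableSet_Ioo
    have : (ae (volume.restrict (Set.Ioo (0 : ℝ) T))).NeBot := by
      rw [ae_neBot, Ne, Measure.restrict_eq_zero]
      simp [hT]
    obtain ⟨σ, h3, h4⟩ := ((ae_restrict_of_ae h1).and h2).exists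
    exact ⟨σ, h4, h3.1 ⟨h4.1.le, h4.2.le⟩, h3.2⟩
  have hσc : ContinuousOn (f σ) (Set.Icc 0 T) :=
    continuousOn_of_eq_add_integral hT.le hσi.intervalIntegrable hσV
  have hTc : ContinuousOn (fun s => f s T) (Set.Icc 0 T) :=
    continuousOn_of_eq_add_integral hT.le hTi hTH
  have hL : 0 < T - σ := by linarith
  have hadd : ∀ c : ℝ, ∀ {p : ℝ → Prop}, (∀ᵐ x, p x) → ∀ᵐ x, p (c + x) := fun c p h =>
    (measurePreserving_add_left volume c).quasiMeasurePreserving.ae h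
  have hsub : ∀ c : ℝ, ∀ {p : ℝ → Prop}, (∀ᵐ x, p x) → ∀ᵐ x, p (c - x) := fun c p h =>
    (Measure.measurePreserving_sub_left volume c).quasiMeasurePreserving.ae h
  have e1 : f σ (T - σ) = f T 0 := by
    have hmaps : Set.MapsTo (fun x : ℝ => σ + x) (Set.Icc 0 (T - σ)) (Set.Icc 0 T) :=
      fun x hx => ⟨by linarith [hx.1], by linarith [hx.2]⟩
    have hc := h0.comp (continuous_const.add continuous_id).continuousOn hmaps
    have h1 : ∀ᵐ t, t ∈ Set.Icc 0 (T - σ) → f (σ + 0) t = f (σ + t) 0 := by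
      refine ae_eq_axes (f := fun p q => f (σ + p) q) (φ := fun p q => φ (σ + p) q) hL.le ?_ ?_ ?_ ?_
      · have := ((measurePreserving_add_left volume σ).prod
          (MeasurePreserving.id (volume : Measure ℝ))).integrable_comp_of_integrable hφ
        exact this
      · filter_upwards [hadd σ hV] with p hp hm t ht
        exact hp ⟨by linarith [hm.1], by linarith [hm.2]⟩ t ⟨ht.1, by linarith [ht.2]⟩
      · filter_upwards [hH, hφ.prod_left_ae] with t ht hi hm s hs
        have hii : ∀ x y, IntervalIntegrable (fun r => φ r t) volume x y :=
          fun _ _ => hi.intervalIntegrable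
        have htT : t ∈ Set.Icc 0 T := ⟨hm.1, by linarith [hm.2]⟩
        rw [ht htT _ ⟨by linarith [hs.1], by linarith [hs.2]⟩,
          ht htT (σ + 0) ⟨by linarith, by linarith⟩,
          intervalIntegral.integral_comp_add_left (fun r => φ r t) σ, add_assoc,
          intervalIntegral.integral_add_adjacent_intervals (hii _ _) (hii _ _)]
      · refine ContinuousOn.intervalIntegrable ?_
        rw [Set.uIcc_of_le hL.le]
        exact hc
    rw [add_zero] at h1
    have h2 := eqOn_Icc_of_ae_eq hL (hσc.mono (Set.Icc_subset_Icc_right (by linarith)))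
      hc h1
      (Set.right_mem_Icc.2 hL.le)
    simpa using h2
  have e2 : f σ (T - σ) = f 0 T := by
    have hmaps : Set.MapsTo (fun x : ℝ => σ - x) (Set.Icc 0 σ) (Set.Icc 0 T) :=
      fun x hx => ⟨by linarith [hx.2], by linarith [hx.1]⟩
    have hmapsT : Set.MapsTo (fun x : ℝ => T - x) (Set.Icc 0 σ) (Set.Icc 0 T) :=
      fun x hx => ⟨by linarith [hx.2], by linarith [hx.1]⟩
    have hTc' := hTc.comp (continuous_const.sub continuous_id).continuousOn hmaps
    have hTT : T ∈ Set.Icc 0 T := Set.right_mem_Icc.2 hT.le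
    have hσm : σ ∈ Set.Icc 0 T := ⟨hσ0.le, hσT.le⟩
    have h1 : ∀ᵐ t, t ∈ Set.Icc 0 σ → f (σ - 0) (T - t) = f (σ - t) (T - 0) := by
      refine ae_eq_axes (f := fun p q => f (σ - p) (T - q)) (φ := fun p q => -φ (σ - p) (T - q))
        hσ0.le ?_ ?_ ?_ ?_
      · have := ((Measure.measurePreserving_sub_left volume σ).prod
          (Measure.measurePreserving_sub_left volume T)).integrable_comp_of_integrable hφ
        exact this.neg
      · filter_upwards [hsub σ hV, hsub σ hφ.prod_right_ae] with p hp hi hm t ht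
        have hii : ∀ x y, IntervalIntegrable (fun r => φ (σ - p) r) volume x y :=
          fun _ _ => hi.intervalIntegrable
        rw [intervalIntegral.integral_neg,
          intervalIntegral.integral_comp_sub_left (fun r => φ (σ - p) r) T, sub_zero,
          hp (hmaps hm) _ (hmapsT ht), hp (hmaps hm) _ hTT,
          ← intervalIntegral.integral_add_adjacent_intervals (b := T - t) (c := T) (hii _ _) (hii _ _)]
        ring
      · filter_upwards [hsub T hH, hsub T hφ.prod_left_ae] with t ht hi hm p hp
        have hii : ∀ x y, IntervalIntegrable (fun r => φ r (T - t)) volume x y :=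
          fun _ _ => hi.intervalIntegrable
        rw [intervalIntegral.integral_neg,
          intervalIntegral.integral_comp_sub_left (fun r => φ r (T - t)) σ, sub_zero,
          ht (hmapsT hm) _ (hmaps hp), ht (hmapsT hm) _ hσm,
          ← intervalIntegral.integral_add_adjacent_intervals (b := σ - p) (c := σ) (hii _ _) (hii _ _)]
        ring
      · refine ContinuousOn.intervalIntegrable ?_
        rw [Set.uIcc_of_le hσ0.le, sub_zero]
        exact hTc'
    rw [sub_zero, sub_zero] at h1
    have h2 := eqOn_Icc_of_ae_eq hσ0
      (hσc.comp (continuous_const.sub continuous_id).continuousOn hmapsT) hTc' h1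
      (Set.right_mem_Icc.2 hσ0.le)
    simpa using h2
  rw [← e2, e1]

/-! ### Joint measurability -/

/-- A right-continuous process on `[0, T]` is jointly measurable: it is the limit, as `n → ∞`, of
its values at the next point of the grid `ℤ / (n + 1)`, or at `T` if that point exceeds `T`. -/
theorem measurable_uncurry_of_rightContinuous {T : ℝ} [Fact (0 < T)] {Ω E : Type*}
    [MeasurableSpace Ω] [TopologicalSpace E] [TopologicalSpace.PseudoMetrizableSpace E]
    [MeasurableSpace E] [BorelSpace E] {Y : Time T → Ω → E} (hY : ∀ t, Measurable (Y t))
    (hc : ∀ ω t, ContinuousWithinAt (fun t => Y t ω) (Set.Ioi t) t) :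
    Measurable (Function.uncurry Y) := by
  have hT : (0 : ℝ) ≤ T := factLe.out
  let c (n : ℕ) (t : Time T) : Time T :=
    Set.projIcc 0 T hT (((⌊(t : ℝ) * (n + 1)⌋ : ℝ) + 1) / (n + 1))
  have hlt : ∀ (n : ℕ) (t : Time T), (t : ℝ) < ((⌊(t : ℝ) * (n + 1)⌋ : ℝ) + 1) / (n + 1) :=
    fun n t => by
      rw [lt_div_iff₀ (by positivity)]; exact Int.lt_floor_add_one _
  have hup : ∀ (n : ℕ) (t : Time T),
      ((⌊(t : ℝ) * (n + 1)⌋ : ℝ) + 1) / (n + 1) ≤ t + 1 / ((n : ℝ) + 1) := fun n t => by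
    rw [add_div]
    gcongr
    rw [div_le_iff₀ (by positivity)]; exact Int.floor_le _
  have hgrid : ∀ t : Time T, Tendsto (fun n : ℕ => ((⌊(t : ℝ) * (n + 1)⌋ : ℝ) + 1) / (n + 1))
      atTop (𝓝 (t : ℝ)) := fun t =>
    tendsto_of_tendsto_of_tendsto_of_le_of_le tendsto_const_nhds
      (by
        simpa using (tendsto_const_nhds (x := (t : ℝ))).add
          (tendsto_one_div_add_atTop_nhds_zero_nat (𝕜 := ℝ)))
      (fun n => (hlt n t).le) (fun n => hup n t)
  have hct : ∀ t : Time T, Tendsto (fun n => c n t) atTop (𝓝 t) := fun t => by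
    have := (continuous_projIcc (h := hT)).continuousAt.tendsto.comp (hgrid t)
    rwa [Set.projIcc_val] at this
  have hlim : ∀ (ω : Ω) (t : Time T), Tendsto (fun n => Y (c n t) ω) atTop (𝓝 (Y t ω)) := by
    intro ω t
    -- The grid points lie strictly to the right of `t`, except at `t = T`, where they equal `T`.
    rcases eq_or_lt_of_le t.2.2 with h | h
    · have : ∀ n, c n t = t := fun n => by
        have h1 : c n t = ⟨T, Set.right_mem_Icc.2 hT⟩ :=
          Set.projIcc_of_right_le hT (h.symm.le.trans (hlt n t).le)
        rw [h1]; exact Subtype.ext h.symm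
      simp only [this]
      exact tendsto_const_nhds
    · refine (hc ω t).tendsto.comp (tendsto_nhdsWithin_iff.2 ⟨hct t, Eventually.of_forall fun n => ?_⟩)
      show (t : ℝ) < max 0 (min T _)
      exact lt_max_of_lt_right (lt_min h (hlt n t))
  refine measurable_of_tendsto_metrizable (f := fun n (p : Time T × Ω) => Y (c n p.1) p.2)
    (fun n => ?_) (tendsto_pi_nhds.2 fun p => hlim p.2 p.1)
  have h1 : Measurable fun p : ℤ × Ω => Y (Set.projIcc 0 T hT (((p.1 : ℝ) + 1) / (n + 1))) p.2 :=
    measurable_from_prod_countable_right fun k => by simpa using hY _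
  have h2 : Measurable fun p : Time T × Ω => ⌊((p.1 : Time T) : ℝ) * ((n : ℝ) + 1)⌋ :=
    Int.measurable_floor.comp ((measurable_subtype_coe.comp measurable_fst).mul_const _)
  have h3 := h1.comp (h2.prodMk measurable_snd)
  exact h3

theorem hasSum_of_mem_coeffOn {d : ℕ} {S : Set (Euc d)} {v : Coeff d} (hv : v ∈ coeffOn S) (x : S) :
    HasSum (term v (toC (x : Euc d))) (hS S v x) := by
  obtain ⟨ε, hε, h, -, hsum⟩ := hv
  have hx : toC (x : Euc d) ∈ nbhdPolydisc S ε := by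
    intro i
    have h1 : ‖(x : Euc d) i‖ₑ ≤ radius S i :=
      le_iSup₂ (f := fun (y : Euc d) (_ : y ∈ S) => ‖y i‖ₑ) (x : Euc d) x.2
    have h2 : ‖toC (x : Euc d) i‖ₑ = ‖(x : Euc d) i‖ₑ := by
      simp only [toC, enorm_eq_nnnorm, Complex.nnnorm_real]
    rw [h2]
    calc ‖(x : Euc d) i‖ₑ < ‖(x : Euc d) i‖ₑ + ENNReal.ofReal ε :=
          ENNReal.lt_add_right enorm_ne_top (ENNReal.ofReal_pos.2 hε).ne'
      _ ≤ _ := add_le_add_left h1 _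
  exact (hsum _ hx).summable.hasSum

/-- The sum of a power series depends measurably on the coefficients and the point together. -/
theorem measurable_hS {d : ℕ} {S : Set (Euc d)} {α : Type*} [MeasurableSpace α] {v : α → Coeff d}
    (hv : ∀ β, Measurable fun a => v a β) (hs : ∀ a, v a ∈ coeffOn S) :
    Measurable fun p : α × S => hS S (v p.1) p.2 := by
  refine measurable_of_tendsto_metrizable' (atTop : Filter (Finset (Fin d → ℕ)))
    (f := fun F (p : α × S) => ∑ β ∈ F, term (v p.1) (toC (p.2 : Euc d)) β) (fun F => ?_)
    (tendsto_pi_nhds.2 fun p => hasSum_of_mem_coeffOn (hs p.1) p.2)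
  refine Finset.measurable_sum _ fun β _ => ?_
  unfold term toC
  refine ((hv β).comp measurable_fst).mul (Measurable.div_const ?_ _)
  refine Finset.measurable_prod _ fun i _ => Measurable.pow_const ?_ _
  refine Complex.measurable_ofReal.comp ?_
  have : Measurable fun y : Euc d => y i := by fun_prop
  exact this.comp (measurable_subtype_coe.comp measurable_snd)

/-! ### Expectations -/

theorem expectation_integral_comm {Ω : Type*} {mΩ : MeasurableSpace Ω} {P : Measure Ω}
    [IsProbabilityMeasure P] {Z : ℝ → Ω → ℂ} (hZ : Measurable (Function.uncurry Z)) {T : ℝ}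
    (hT : 0 ≤ T) (hfin : ∫⁻ r in Set.Icc 0 T, ∫⁻ ω, ‖Z r ω‖ₑ ∂P < ∞) :
    IntervalIntegrable (fun r => ∫ ω, Z r ω ∂P) volume 0 T ∧
    ∀ t ∈ Set.Icc 0 T, Integrable (fun ω => ∫ r in (0 : ℝ)..t, Z r ω) P ∧
      ∫ ω, (∫ r in (0 : ℝ)..t, Z r ω) ∂P = ∫ r in (0 : ℝ)..t, ∫ ω, Z r ω ∂P := by
  have hI : Integrable (Function.uncurry Z) ((volume.restrict (Set.Icc 0 T)).prod P) := by
    refine ⟨hZ.aestronglyMeasurable, ?_⟩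
    rw [hasFiniteIntegral_iff_enorm, lintegral_prod _ hZ.enorm.aemeasurable]
    exact hfin
  refine ⟨(intervalIntegrable_iff_integrableOn_Icc_of_le hT).2 hI.integral_prod_left,
    fun t ht => ?_⟩
  have hIt : Integrable (Function.uncurry Z) ((volume.restrict (Set.Ioc 0 t)).prod P) := by
    have h1 := hI.restrict (s := Set.Ioc 0 t ×ˢ Set.univ)
    rwa [← Measure.prod_restrict, Measure.restrict_univ,
      Measure.restrict_restrict measurableSet_Ioc, Set.inter_eq_left.2] at h1
    exact fun x hx => ⟨hx.1.le, hx.2.trans ht.2⟩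
  simp only [intervalIntegral.integral_of_le ht.1]
  exact ⟨hIt.integral_prod_right, (integral_integral_swap hIt).symm⟩

/-- Dynkin's formula: expectations of a centred process `G(X_t) - G(X_0) - ∫_0^t k(X_r) dr`. -/
theorem expectation_eq_of_dynkin {Ω S : Type*} {mΩ : MeasurableSpace Ω} {P : Measure Ω}
    [IsProbabilityMeasure P] [MeasurableSpace S] {X : ℝ → Ω → S}
    (hX : Measurable (Function.uncurry X)) {G k : S → ℂ} (hk : Measurable k) {T : ℝ} (hT : 0 ≤ T)
    {x₀ : S} (hx₀ : ∀ᵐ ω ∂P, X 0 ω = x₀)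
    (hfin : ∫⁻ r in Set.Icc 0 T, ∫⁻ ω, ‖k (X r ω)‖ₑ ∂P < ∞)
    (hN : ∀ t ∈ Set.Icc 0 T,
      Integrable (fun ω => G (X t ω) - G (X 0 ω) - ∫ r in (0 : ℝ)..t, k (X r ω)) P ∧
      ∫ ω, (G (X t ω) - G (X 0 ω) - ∫ r in (0 : ℝ)..t, k (X r ω)) ∂P = 0) :
    IntervalIntegrable (fun r => ∫ ω, k (X r ω) ∂P) volume 0 T ∧
    ∀ t ∈ Set.Icc 0 T, Integrable (fun ω => G (X t ω)) P ∧
      ∫ ω, G (X t ω) ∂P = G x₀ + ∫ r in (0 : ℝ)..t, ∫ ω, k (X r ω) ∂P := by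
  obtain ⟨h1, h2⟩ := expectation_integral_comm (Z := fun r ω => k (X r ω)) (hk.comp hX) hT hfin
  refine ⟨h1, fun t ht => ?_⟩
  obtain ⟨i1, e1⟩ := h2 t ht
  obtain ⟨i2, e2⟩ := hN t ht
  have hc : (fun ω => G (X t ω)) =ᵐ[P] fun ω =>
      (G (X t ω) - G (X 0 ω) - ∫ r in (0 : ℝ)..t, k (X r ω)) +
        (G x₀ + ∫ r in (0 : ℝ)..t, k (X r ω)) := by
    filter_upwards [hx₀] with ω hω
    rw [hω]; ring
  have i3 : Integrable (fun ω => G x₀ + ∫ r in (0 : ℝ)..t, k (X r ω)) P :=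
    (integrable_const _).add i1
  refine ⟨(i2.add i3).congr hc.symm, ?_⟩
  rw [integral_congr_ae hc, integral_add i2 i3, e2, zero_add,
    integral_add (integrable_const _) i1, e1]
  simp

/-- The expectation of a pointwise primitive `g` of `k`. Integrability of `g σ (Y)` at a single `σ`
suffices, since the increments of `g` are integrable. -/
theorem expectation_eq_of_primitive {Ω S : Type*} {mΩ : MeasurableSpace Ω} {P : Measure Ω}
    [IsProbabilityMeasure P] [MeasurableSpace S] {Y : Ω → S} (hY : Measurable Y)
    {g k : ℝ → S → ℂ} (hk : Measurable (Function.uncurry k)) {T : ℝ} (hT : 0 ≤ T)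
    (hg : ∀ x, ∀ s ∈ Set.Icc 0 T, g s x = g 0 x + ∫ r in (0 : ℝ)..s, k r x)
    (hfin : ∫⁻ r in Set.Icc 0 T, ∫⁻ ω, ‖k r (Y ω)‖ₑ ∂P < ∞)
    {σ : ℝ} (hσ : σ ∈ Set.Icc 0 T) (hσi : Integrable (fun ω => g σ (Y ω)) P) :
    IntervalIntegrable (fun r => ∫ ω, k r (Y ω) ∂P) volume 0 T ∧
    ∀ s ∈ Set.Icc 0 T, Integrable (fun ω => g s (Y ω)) P ∧
      ∫ ω, g s (Y ω) ∂P = ∫ ω, g 0 (Y ω) ∂P + ∫ r in (0 : ℝ)..s, ∫ ω, k r (Y ω) ∂P := by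
  obtain ⟨h1, h2⟩ := expectation_integral_comm (Z := fun r ω => k r (Y ω))
    (hk.comp (measurable_fst.prodMk (hY.comp measurable_snd))) hT hfin
  have h0 : Integrable (fun ω => g 0 (Y ω)) P := by
    refine (hσi.sub (h2 σ hσ).1).congr (ae_of_all _ fun ω => ?_)
    simp only [Pi.sub_apply, hg (Y ω) σ hσ, add_sub_cancel_right]
  refine ⟨h1, fun s hs => ?_⟩
  simp only [hg _ s hs]
  exact ⟨h0.add (h2 s hs).1, by rw [integral_add h0 (h2 s hs).1, (h2 s hs).2]⟩

/-- The duality argument. The functions `g s` solve `∂_s g = k` pointwise and the processes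
`g s (X_t) - g s (X_0) - ∫_0^t k s (X_r) dr` are centred, so that `(s, t) ↦ E[g s (X_t)]` has the
same partial derivative in both variables. -/
theorem expectation_duality {Ω S : Type*} {mΩ : MeasurableSpace Ω} {P : Measure Ω}
    [IsProbabilityMeasure P] [MeasurableSpace S] {X : ℝ → Ω → S}
    (hX : Measurable (Function.uncurry X)) {g k : ℝ → S → ℂ}
    (hk : Measurable (Function.uncurry k)) {T : ℝ} (hT : 0 < T)
    (hki : ∀ x, IntervalIntegrable (fun r => k r x) volume 0 T)
    (hg : ∀ x, ∀ s ∈ Set.Icc 0 T, g s x = g 0 x + ∫ r in (0 : ℝ)..s, k r x)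
    {x₀ : S} (hx₀ : ∀ᵐ ω ∂P, X 0 ω = x₀)
    (hfin : ∫⁻ t in Set.Icc 0 T, ∫⁻ s in Set.Icc 0 T, ∫⁻ ω, ‖k s (X t ω)‖ₑ ∂P < ∞)
    (hN : ∀ᵐ s ∂volume.restrict (Set.Icc 0 T), ∀ t ∈ Set.Icc 0 T,
      Integrable (fun ω => g s (X t ω) - g s (X 0 ω) - ∫ r in (0 : ℝ)..t, k s (X r ω)) P ∧
      ∫ ω, (g s (X t ω) - g s (X 0 ω) - ∫ r in (0 : ℝ)..t, k s (X r ω)) ∂P = 0) :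
    (∀ᵐ t ∂volume.restrict (Set.Icc 0 T),
      Integrable (fun ω => g 0 (X t ω)) P ∧ ∫ ω, g 0 (X t ω) ∂P = g t x₀) ∧
    (∀ k₀ : S → ℂ, Measurable k₀ → ∫⁻ r in Set.Icc 0 T, ∫⁻ ω, ‖k₀ (X r ω)‖ₑ ∂P < ∞ →
      (∀ t ∈ Set.Icc 0 T,
        Integrable (fun ω => g 0 (X t ω) - g 0 (X 0 ω) - ∫ r in (0 : ℝ)..t, k₀ (X r ω)) P ∧
        ∫ ω, (g 0 (X t ω) - g 0 (X 0 ω) - ∫ r in (0 : ℝ)..t, k₀ (X r ω)) ∂P = 0) →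
      Integrable (fun ω => g 0 (X T ω)) P ∧ ∫ ω, g 0 (X T ω) ∂P = g T x₀) ∧
    (∫⁻ s in Set.Icc 0 T, ∫⁻ ω, ‖k s (X T ω)‖ₑ ∂P < ∞ →
      Integrable (fun ω => g 0 (X T ω)) P ∧ ∫ ω, g 0 (X T ω) ∂P = g T x₀) := by
  set ν := volume.restrict (Set.Icc 0 T) with hν
  have hνI : ∀ᵐ s ∂ν, s ∈ Set.Icc 0 T := self_mem_ae_restrict measurableSet_Icc
  have hνne : (ae ν).NeBot := by
    rw [ae_neBot, Ne, hν, Measure.restrict_eq_zero]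
    simp [hT]
  have h0m : (0 : ℝ) ∈ Set.Icc 0 T := Set.left_mem_Icc.2 hT.le
  have hTm : T ∈ Set.Icc 0 T := Set.right_mem_Icc.2 hT.le
  set f : ℝ → ℝ → ℂ := fun s t => ∫ ω, g s (X t ω) ∂P with hf
  set m : ℝ → ℝ → ℂ := fun s t => ∫ ω, k s (X t ω) ∂P with hm
  have hkX : Measurable fun p : (ℝ × ℝ) × Ω => k p.1.1 (X p.1.2 p.2) :=
    hk.comp ((measurable_fst.comp measurable_fst).prodMk
      (hX.comp ((measurable_snd.comp measurable_fst).prodMk measurable_snd)))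
  set Q : ℝ → ℝ → ℝ≥0∞ := fun s t => ∫⁻ ω, ‖k s (X t ω)‖ₑ ∂P with hQ
  have hQm : Measurable (Function.uncurry Q) := hkX.enorm.lintegral_prod_right'
  have hQt : ∀ᵐ t ∂ν, ∫⁻ s, Q s t ∂ν < ∞ :=
    ae_lt_top (Measurable.lintegral_prod_right' (hQm.comp measurable_swap)) hfin.ne
  have hfin' : ∫⁻ s, ∫⁻ t, Q s t ∂ν ∂ν < ∞ := by
    rwa [lintegral_lintegral_swap hQm.aemeasurable]
  have hQs : ∀ᵐ s ∂ν, ∫⁻ t, Q s t ∂ν < ∞ :=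
    ae_lt_top (Measurable.lintegral_prod_right' hQm) hfin'.ne
  have hmm : StronglyMeasurable (Function.uncurry m) :=
    hkX.stronglyMeasurable.integral_prod_right'
  have hmi : Integrable (Function.uncurry m) (ν.prod ν) := by
    refine ⟨hmm.aestronglyMeasurable, ?_⟩
    rw [hasFiniteIntegral_iff_enorm]
    refine lt_of_le_of_lt (lintegral_mono (g := Function.uncurry Q) fun p =>
      enorm_integral_le_lintegral_enorm _) ?_
    rw [lintegral_prod _ hQm.aemeasurable]
    exact hfin'
  -- `m` is cut off outside the square, so that global invariances of Lebesgue measure apply.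
  set φ : ℝ → ℝ → ℂ := fun s t =>
    (Set.Icc 0 T ×ˢ Set.Icc 0 T).indicator (Function.uncurry m) (s, t) with hφd
  have hφ : Integrable (Function.uncurry φ) (volume.prod volume) := by
    have : Integrable ((Set.Icc 0 T ×ˢ Set.Icc 0 T).indicator (Function.uncurry m))
        (volume.prod volume) := by
      rw [integrable_indicator_iff (measurableSet_Icc.prod measurableSet_Icc), IntegrableOn,
        ← Measure.prod_restrict]
      exact hmi
    exact this
  have hφm : ∀ s ∈ Set.Icc 0 T, ∀ t ∈ Set.Icc 0 T, φ s t = m s t := fun s hs t ht =>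
    Set.indicator_of_mem (show (s, t) ∈ Set.Icc 0 T ×ˢ Set.Icc 0 T from ⟨hs, ht⟩) _
  have hφs : ∀ s ∈ Set.Icc 0 T, ∀ t ∈ Set.Icc 0 T,
      ∫ r in (0 : ℝ)..t, φ s r = ∫ r in (0 : ℝ)..t, m s r := fun s hs t ht =>
    intervalIntegral.integral_congr fun r hr => by
      rw [Set.uIcc_of_le ht.1] at hr
      exact hφm s hs r ⟨hr.1, hr.2.trans ht.2⟩
  have hφt : ∀ t ∈ Set.Icc 0 T, ∀ s ∈ Set.Icc 0 T,
      ∫ r in (0 : ℝ)..s, φ r t = ∫ r in (0 : ℝ)..s, m r t := fun t ht s hs =>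
    intervalIntegral.integral_congr fun r hr => by
      rw [Set.uIcc_of_le hs.1] at hr
      exact hφm r ⟨hr.1, hr.2.trans hs.2⟩ t ht
  have hf0 : ∀ s, f s 0 = g s x₀ := fun s => by
    have : (fun ω => g s (X 0 ω)) =ᵐ[P] fun _ => g s x₀ := by
      filter_upwards [hx₀] with ω hω; rw [hω]
    simp only [hf]
    rw [integral_congr_ae this]; simp
  have hf0c : ContinuousOn (fun s => f s 0) (Set.Icc 0 T) := by
    simp only [hf0]
    exact continuousOn_of_eq_add_integral hT.le (hki x₀) (hg x₀)
  have hVs : ∀ᵐ s ∂ν, ∀ t ∈ Set.Icc 0 T, Integrable (fun ω => g s (X t ω)) P ∧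
      f s t = g s x₀ + ∫ r in (0 : ℝ)..t, m s r := by
    filter_upwards [hQs, hN] with s hs hNs
    exact (expectation_eq_of_dynkin (k := k s) hX (hk.comp measurable_prodMk_left) hT.le hx₀ hs
      hNs).2
  -- One regular `σ` provides integrability at every time `t`, which `hHt` transfers to all `s`.
  obtain ⟨σ, hσV, hσ⟩ := (hVs.and hνI).exists
  have hHt : ∀ t ∈ Set.Icc 0 T, ∫⁻ s, Q s t ∂ν < ∞ →
      IntervalIntegrable (fun r => m r t) volume 0 T ∧
      ∀ s ∈ Set.Icc 0 T, Integrable (fun ω => g s (X t ω)) P ∧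
        f s t = f 0 t + ∫ r in (0 : ℝ)..s, m r t := fun t ht hQ =>
    expectation_eq_of_primitive (hX.comp measurable_prodMk_left) hk hT.le hg hQ hσ
      (hσV t ht).1
  have hV : ∀ᵐ s, s ∈ Set.Icc 0 T → ∀ t ∈ Set.Icc 0 T,
      f s t = f s 0 + ∫ r in (0 : ℝ)..t, φ s r := by
    refine (ae_restrict_iff' measurableSet_Icc).1 ?_
    filter_upwards [hVs, hνI] with s hs hsm t ht
    rw [hf0, hφs s hsm t ht, (hs t ht).2]
  have hH : ∀ᵐ t, t ∈ Set.Icc 0 T → ∀ s ∈ Set.Icc 0 T,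
      f s t = f 0 t + ∫ r in (0 : ℝ)..s, φ r t := by
    refine (ae_restrict_iff' measurableSet_Icc).1 ?_
    filter_upwards [hQt, hνI] with t ht htm s hs
    rw [hφt t htm s hs]
    exact ((hHt t htm ht).2 s hs).2
  have hmain : ∀ᵐ t, t ∈ Set.Icc 0 T → f 0 t = f t 0 :=
    ae_eq_axes hT.le hφ hV hH (by
      refine ContinuousOn.intervalIntegrable ?_
      rwa [Set.uIcc_of_le hT.le])
  refine ⟨?_, fun k₀ hk₀ hfin₀ hN₀ => ?_, fun hfinT => ?_⟩
  · filter_upwards [(ae_restrict_iff' measurableSet_Icc).2 hmain, hQt, hνI] with t ht hq htm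
    exact ⟨((hHt t htm hq).2 0 h0m).1, ht.trans (hf0 t)⟩
  · obtain ⟨h1, h2⟩ := expectation_eq_of_dynkin hX hk₀ hT.le hx₀ hfin₀ hN₀
    refine ⟨(h2 T hTm).1, ?_⟩
    have h3 := eqOn_Icc_of_ae_eq hT
      (continuousOn_of_eq_add_integral hT.le h1 fun t ht => (h2 t ht).2) hf0c hmain hTm
    exact h3.trans (hf0 T)
  · obtain ⟨h1, h2⟩ := hHt T hTm hfinT
    refine ⟨(h2 0 h0m).1, ?_⟩
    rw [← hf0 T]
    refine eq_corner hT hφ hV hH hf0c (h1.congr fun r hr => ?_) fun s hs => ?_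
    · rw [Set.uIoc_of_le hT.le] at hr
      exact (hφm r ⟨hr.1.le, hr.2⟩ T hTm).symm
    · rw [hφt T hTm s hs]; exact (h2 s hs).2

/-! ### Processes on the time interval -/

theorem map_val_leb (T : ℝ) :
    Measure.map Subtype.val (leb T) = volume.restrict (Set.Icc (0 : ℝ) T) :=
  map_comap_subtype_coe measurableSet_Icc volume

theorem lintegral_leb {T : ℝ} (hT : 0 ≤ T) (f : Time T → ℝ≥0∞) :
    ∫⁻ t, f t ∂(leb T) = ∫⁻ t in Set.Icc 0 T, f (Set.projIcc 0 T hT t) := by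
  rw [← map_val_leb, (MeasurableEmbedding.subtype_coe measurableSet_Icc).lintegral_map]
  simp only [Set.projIcc_val]

theorem ae_leb {T : ℝ} (hT : 0 ≤ T) {p : Time T → Prop} :
    (∀ᵐ t ∂(leb T), p t) ↔
      ∀ᵐ t ∂volume.restrict (Set.Icc 0 T), p (Set.projIcc 0 T hT t) := by
  rw [← map_val_leb, (MeasurableEmbedding.subtype_coe measurableSet_Icc).ae_map_iff]
  simp only [Set.projIcc_val]

theorem setIntegral_leb {T : ℝ} (hT : 0 ≤ T) (f : Time T → ℂ) {t : ℝ} (ht : t ∈ Set.Icc 0 T) :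
    ∫ s in Set.Iic (Set.projIcc 0 T hT t), f s ∂(leb T) =
      ∫ r in (0 : ℝ)..t, f (Set.projIcc 0 T hT r) := by
  have h1 := (MeasurableEmbedding.subtype_coe (measurableSet_Icc (a := (0 : ℝ)) (b := T))).setIntegral_map
    (μ := leb T) (fun r => f (Set.projIcc 0 T hT r)) (Set.Iic t)
  have h2 : (Subtype.val : Time T → ℝ) ⁻¹' Set.Iic t = Set.Iic (Set.projIcc 0 T hT t) := by
    rw [Set.projIcc_of_mem hT ht]; rfl
  have h3 : Set.Iic t ∩ Set.Icc 0 T = Set.Icc 0 t := by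
    ext x; exact ⟨fun h => ⟨h.2.1, h.1⟩, fun h => ⟨h.2, h.1, h.2.trans ht.2⟩⟩
  rw [h2, map_val_leb, Measure.restrict_restrict measurableSet_Iic, h3] at h1
  simp only [Set.projIcc_val] at h1
  rw [← h1, integral_Icc_eq_integral_Ioc, intervalIntegral.integral_of_le ht.1]

/-- `dynkin X F k` vanishes at time zero, because `{⊥}` is a null set for `leb T`, so that the
martingale is centred at all times. -/
theorem DynkinMart.integral_eq_zero {T : ℝ} [Fact (0 < T)] {Ω S : Type*} {mΩ : MeasurableSpace Ω}
    {P : Measure Ω} [IsProbabilityMeasure P] {𝓕 : Filtration (Time T) mΩ} {X : Time T → Ω → S}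
    {F k : S → ℂ} (h : DynkinMart 𝓕 P X F k) (hT : 0 ≤ T) {t : ℝ} (ht : t ∈ Set.Icc 0 T) :
    Integrable (fun ω => F (X (Set.projIcc 0 T hT t) ω) - F (X (Set.projIcc 0 T hT 0) ω) -
      ∫ r in (0 : ℝ)..t, k (X (Set.projIcc 0 T hT r) ω)) P ∧
    ∫ ω, (F (X (Set.projIcc 0 T hT t) ω) - F (X (Set.projIcc 0 T hT 0) ω) -
      ∫ r in (0 : ℝ)..t, k (X (Set.projIcc 0 T hT r) ω)) ∂P = 0 := by
  have hbot : Set.projIcc 0 T hT 0 = (⊥ : Time T) := Set.projIcc_left hT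
  have e : ∀ s ∈ Set.Icc 0 T, dynkin X F k (Set.projIcc 0 T hT s) = fun ω =>
      F (X (Set.projIcc 0 T hT s) ω) - F (X (Set.projIcc 0 T hT 0) ω) -
      ∫ r in (0 : ℝ)..s, k (X (Set.projIcc 0 T hT r) ω) := fun s hs => by
    funext ω
    rw [dynkin, setIntegral_leb hT (fun r => k (X r ω)) hs, hbot]
  rw [← e t ht]
  refine ⟨h.2.integrable _, ?_⟩
  have h1 := h.2.setIntegral_eq (bot_le (a := Set.projIcc 0 T hT t)) MeasurableSet.univ
  rw [setIntegral_univ, setIntegral_univ] at h1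
  rw [← h1, ← hbot, e 0 (Set.left_mem_Icc.2 hT)]
  simp

/-! ### The generator along a solution of the Riccati equation -/

theorem zero_mem_coeffOn {d : ℕ} (S : Set (Euc d)) : (0 : Coeff d) ∈ coeffOn S :=
  ⟨1, one_pos, 0, differentiableOn_const 0, fun z _ => by
    have : term (0 : Coeff d) z = 0 := by funext α; simp [term]
    rw [this]; exact hasSum_zero⟩

/-- The coefficients `R (ψ s)` are integrable in `s` but need not be Borel measurable. This is a
measurable version, which agrees with them at all times outside a null set. -/
theorem exists_measurable_coeff {d : ℕ} {S : Set (Euc d)} {w : ℝ → Coeff d} {T : ℝ} (hT : 0 ≤ T)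
    (hw : ∀ s ∈ Set.Icc 0 T, w s ∈ coeffOn S)
    (hi : ∀ α, IntervalIntegrable (fun s => w s α) volume 0 T) :
    ∃ r : ℝ → Coeff d, (∀ α, Measurable fun s => r s α) ∧ (∀ s, r s ∈ coeffOn S) ∧
      ∀ᵐ s ∂volume.restrict (Set.Icc 0 T), r s = w s := by
  have hm : ∀ α, AEStronglyMeasurable (fun s => w s α) (volume.restrict (Set.Icc 0 T)) := fun α =>
    ((intervalIntegrable_iff_integrableOn_Icc_of_le hT).1 (hi α)).aestronglyMeasurable
  obtain ⟨G, hG, hGm, hGp⟩ := ((ae_all_iff.2 fun α => (hm α).ae_eq_mk).and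
    (self_mem_ae_restrict (measurableSet_Icc (a := (0 : ℝ)) (b := T)))).exists_measurable_mem
  -- Setting the coefficients to zero off `G` keeps them in `coeffOn S` at every time.
  have hr : ∀ s ∈ G, (fun α => G.indicator ((hm α).mk _) s) = w s := fun s hs => by
    funext α
    rw [Set.indicator_of_mem hs]; exact ((hGp s hs).1 α).symm
  refine ⟨fun s α => G.indicator ((hm α).mk _) s,
    fun α => (hm α).stronglyMeasurable_mk.measurable.indicator hGm, fun s => ?_, ?_⟩
  · show (fun α => G.indicator ((hm α).mk _) s) ∈ coeffOn S
    by_cases hs : s ∈ G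
    · rw [hr s hs]; exact hw s (hGp s hs).2
    · have : (fun α => G.indicator ((hm α).mk _) s) = (0 : Coeff d) := by
        funext α; exact Set.indicator_of_notMem hs _
      rw [this]; exact zero_mem_coeffOn S
  · filter_upwards [hG] with s hs using hr s hs

theorem measurable_process {T : ℝ} [Fact (0 < T)] (hT : 0 ≤ T) {Ω : Type*} {mΩ : MeasurableSpace Ω}
    {d : ℕ} {S : Set (Euc d)} {𝓕 : Filtration (Time T) mΩ} {X : Time T → Ω → S}
    (hX : ∀ t, Measurable[𝓕 t] (X t)) (hc : ∀ ω, IsCadlagPath fun t => (X t ω : Euc d)) :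
    Measurable (Function.uncurry fun t ω => X (Set.projIcc 0 T hT t) ω) := by
  have h1 := measurable_uncurry_of_rightContinuous (Y := fun t ω => (X t ω : Euc d))
    (fun t => measurable_subtype_coe.comp ((hX t).mono (𝓕.le t) le_rfl)) (fun ω t => (hc ω t).1)
  have h2 : Measurable (Function.uncurry X) := h1.subtype_mk (h := fun p => (X p.1 p.2).2)
  have h3 : Measurable fun s => (Set.projIcc 0 T hT s : Time T) := continuous_projIcc.measurable
  have h4 : Measurable fun p : ℝ × Ω => ((Set.projIcc 0 T hT p.1 : Time T), p.2) :=
    (h3.comp measurable_fst).prodMk measurable_snd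
  exact h2.comp h4

theorem measurable_hS_of_mem {d : ℕ} {S : Set (Euc d)} {v : Coeff d} (hv : v ∈ coeffOn S) :
    Measurable (hS S v) := by
  have h1 : Measurable fun p : Unit × S => hS S v p.2 :=
    measurable_hS (v := fun _ => v) (fun _ => measurable_const) fun _ => hv
  have h2 : Measurable fun x : S => ((), x) := measurable_prodMk_left
  have h3 := h1.comp h2
  exact h3

/-- Along a solution of the Riccati equation, `s ↦ exp (h_{ψ(s)})` is a pointwise primitive of
`s ↦ A exp (h_{ψ(s)})`. The latter has a jointly measurable version `k`, so that Tonelli's theorem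
applies to the iterated lower integrals. -/
theorem IsRiccatiSolution.exists_measurable_generator {d : ℕ} {S : Set (Euc d)}
    {A : (S → ℂ) → (S → ℂ)} {V : Set (S → ℂ)} {R : Coeff d → Coeff d}
    (hR : ∀ v ∈ dualSet V, R v ∈ coeffOn S ∧
      A (expFun (hS S v)) = expFun (hS S v) * hS S (R v))
    {T : ℝ} (hT : 0 ≤ T) {u : Coeff d} {ψ : ℝ → Coeff d} (hψ : IsRiccatiSolution V R T u ψ) :
    ∃ k : ℝ → S → ℂ, Measurable (Function.uncurry k) ∧
      (∀ᵐ s ∂volume.restrict (Set.Icc 0 T), k s = A (expFun (hS S (ψ s)))) ∧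
      (∀ x, IntervalIntegrable (fun s => k s x) volume 0 T) ∧
      ∀ x, ∀ s ∈ Set.Icc 0 T,
        expFun (hS S (ψ s)) x = expFun (hS S (ψ 0)) x + ∫ r in (0 : ℝ)..s, k r x := by
  set c : ℝ → ℝ := fun s => Set.projIcc 0 T hT s with hc
  have hcm : ∀ s, c s ∈ Set.Icc 0 T := fun s => (Set.projIcc 0 T hT s).2
  have hcs : ∀ s ∈ Set.Icc 0 T, c s = s := fun s hs => by
    simp only [hc, Set.projIcc_of_mem hT hs]
  have h0m : (0 : ℝ) ∈ Set.Icc 0 T := Set.left_mem_Icc.2 hT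
  obtain ⟨r, hrm, hrS, hrψ⟩ := exists_measurable_coeff (w := fun s => R (ψ s)) hT
    (fun s hs => (hR _ (hψ.mem s hs)).1) hψ.integrable_coeff
  have hψm : ∀ α, Measurable fun s => ψ (c s) α := fun α => by
    have h1 := continuousOn_of_eq_add_integral hT (hψ.integrable_coeff α)
      (fun t ht => hψ.eq_coeff t ht α)
    exact (h1.comp_continuous (continuous_subtype_val.comp continuous_projIcc) hcm).measurable
  have hIcc : ∀ᵐ s ∂volume.restrict (Set.Icc 0 T), s ∈ Set.Icc 0 T :=
    self_mem_ae_restrict measurableSet_Icc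
  have hchain := fun x : S => exp_eq_add_integral
    (H := fun s => hS S (ψ s) x) hT (hψ.integrable_point x)
    (fun s hs => by rw [hψ.eq_point s hs x, hψ.eq_point 0 h0m x]; simp)
  have hkx : ∀ x : S, ∀ t ∈ Set.Icc 0 T, ∀ᵐ s, s ∈ Set.uIoc 0 t →
      Complex.exp (hS S (ψ s) x) * hS S (R (ψ s)) x =
        Complex.exp (hS S (ψ (c s)) x) * hS S (r s) x := fun x t ht => by
    filter_upwards [(ae_restrict_iff' measurableSet_Icc).1 hrψ] with s hs hm
    rw [Set.uIoc_of_le ht.1] at hm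
    have hm' : s ∈ Set.Icc 0 T := ⟨hm.1.le, hm.2.trans ht.2⟩
    rw [hs hm', hcs s hm']
  refine ⟨fun s x => Complex.exp (hS S (ψ (c s)) x) * hS S (r s) x, ?_, ?_, fun x => ?_,
    fun x s hs => ?_⟩
  · exact (Complex.measurable_exp.comp (measurable_hS hψm fun s => (hψ.mem _ (hcm s)).1)).mul
      (measurable_hS hrm hrS)
  · filter_upwards [hrψ, hIcc] with s hs hsm
    rw [(hR _ (hψ.mem s hsm)).2, hs, hcs s hsm]
    rfl
  · exact (hchain x).1.congr_ae
      ((ae_restrict_iff' measurableSet_uIoc).2 (hkx x T (Set.right_mem_Icc.2 hT)))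
  · exact ((hchain x).2 s hs).trans
      (congrArg _ (intervalIntegral.integral_congr_ae (hkx x s hs)))

end AffHol

theorem theorem4p8 {d : ℕ} {S : Set (AffHol.Euc d)} {T : ℝ} [Fact (0 < T)]
    {Ω : Type*} {mΩ : MeasurableSpace Ω} (P : Measure Ω) [IsProbabilityMeasure P]
    (𝓕 : Filtration (AffHol.Time T) mΩ)
    (b : S → AffHol.Euc d) (a : S → Matrix (Fin d) (Fin d) ℝ) (K : Kernel S (AffHol.Euc d))
    (A : (S → ℂ) → (S → ℂ)) (V : Set (S → ℂ)) (X : AffHol.Time T → Ω → S)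
    (hX : AffHol.IsAffineHolomorphic b a K A V 𝓕 P X)
    -- the operator `R : V* → S*` with `A exp(h_v) = exp(h_v) h_{R(v)}` on `S`
    (R : AffHol.Coeff d → AffHol.Coeff d)
    (hR : ∀ v ∈ AffHol.dualSet V, R v ∈ AffHol.coeffOn S ∧
      A (AffHol.expFun (AffHol.hS S v)) = AffHol.expFun (AffHol.hS S v) * AffHol.hS S (R v))
    (x₀ : S) (hx₀ : ∀ᵐ ω ∂P, X ⊥ ω = x₀)
    (u : AffHol.Coeff d) (hu : u ∈ AffHol.dualSet V)
    (ψ : ℝ → AffHol.Coeff d) (hψ : AffHol.IsRiccatiSolution V R T u ψ)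
    (hmart : ∀ s ∈ Set.Icc (0 : ℝ) T,
      AffHol.DynkinMart 𝓕 P X (AffHol.expFun (AffHol.hS S (ψ s)))
        (A (AffHol.expFun (AffHol.hS S (ψ s)))))
    (hint : ∫⁻ t, (∫⁻ s in Set.Icc (0 : ℝ) T,
      ∫⁻ ω, ‖A (AffHol.expFun (AffHol.hS S (ψ s))) (X t ω)‖ₑ ∂P) ∂(AffHol.leb T) < ∞) :
    -- the formula at almost every time
    (∀ᵐ t ∂(AffHol.leb T),
      Integrable (fun ω => Complex.exp (AffHol.hS S u (X t ω))) P ∧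
      ∫ ω, Complex.exp (AffHol.hS S u (X t ω)) ∂P = Complex.exp (AffHol.hS S (ψ t) x₀)) ∧
    -- the formula at the terminal time, if the integrability also holds on one boundary slice
    (((∫⁻ t, (∫⁻ ω, ‖A (AffHol.expFun (AffHol.hS S u)) (X t ω)‖ₑ ∂P) ∂(AffHol.leb T) < ∞) ∨
      (∫⁻ s in Set.Icc (0 : ℝ) T,
        ∫⁻ ω, ‖A (AffHol.expFun (AffHol.hS S (ψ s))) (X ⊤ ω)‖ₑ ∂P < ∞)) →
      Integrable (fun ω => Complex.exp (AffHol.hS S u (X ⊤ ω))) P ∧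
      ∫ ω, Complex.exp (AffHol.hS S u (X ⊤ ω)) ∂P = Complex.exp (AffHol.hS S (ψ T) x₀)) := by
  have hT0 : 0 < T := Fact.out
  have hT : 0 ≤ T := hT0.le
  have hbot : Set.projIcc 0 T hT 0 = ⊥ := Set.projIcc_left hT
  have htop : Set.projIcc 0 T hT T = ⊤ := Set.projIcc_right hT
  have h0m : (0 : ℝ) ∈ Set.Icc 0 T := Set.left_mem_Icc.2 hT
  have hψ0 : ψ 0 = u := by
    funext α
    rw [hψ.eq_coeff 0 h0m α]; simp
  obtain ⟨k, hkm, hkA, hki, hg⟩ := hψ.exists_measurable_generator hR hT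
  have hIcc : ∀ᵐ s ∂volume.restrict (Set.Icc 0 T), s ∈ Set.Icc 0 T :=
    self_mem_ae_restrict measurableSet_Icc
  have hfin : ∫⁻ t in Set.Icc 0 T, ∫⁻ s in Set.Icc 0 T,
      ∫⁻ ω, ‖k s (X (Set.projIcc 0 T hT t) ω)‖ₑ ∂P < ∞ := by
    rw [AffHol.lintegral_leb hT] at hint
    refine lt_of_eq_of_lt (lintegral_congr fun t => lintegral_congr_ae ?_) hint
    filter_upwards [hkA] with s hs
    rw [hs]
  have hN : ∀ᵐ s ∂volume.restrict (Set.Icc 0 T), ∀ t ∈ Set.Icc 0 T,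
      Integrable (fun ω => AffHol.expFun (AffHol.hS S (ψ s)) (X (Set.projIcc 0 T hT t) ω) -
        AffHol.expFun (AffHol.hS S (ψ s)) (X (Set.projIcc 0 T hT 0) ω) -
        ∫ r in (0 : ℝ)..t, k s (X (Set.projIcc 0 T hT r) ω)) P ∧
      ∫ ω, (AffHol.expFun (AffHol.hS S (ψ s)) (X (Set.projIcc 0 T hT t) ω) -
        AffHol.expFun (AffHol.hS S (ψ s)) (X (Set.projIcc 0 T hT 0) ω) -
        ∫ r in (0 : ℝ)..t, k s (X (Set.projIcc 0 T hT r) ω)) ∂P = 0 := by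
    filter_upwards [hkA, hIcc] with s hs hsm t ht
    have hm := hmart s hsm
    rw [← hs] at hm
    exact hm.integral_eq_zero hT ht
  obtain ⟨c1, c2, c3⟩ := AffHol.expectation_duality (x₀ := x₀)
    (AffHol.measurable_process hT hX.jumpDiffusion.adapted hX.jumpDiffusion.cadlag)
    hkm hT0 hki hg (by rwa [hbot]) hfin hN
  rw [hψ0] at c1 c2 c3
  rw [htop] at c2 c3
  refine ⟨(AffHol.ae_leb hT).2 ?_, fun h => h.elim (fun h0 => ?_) fun h1 => ?_⟩
  · filter_upwards [c1, hIcc] with t ht htm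
    have e : ((Set.projIcc 0 T hT t : AffHol.Time T) : ℝ) = t := by
      rw [Set.projIcc_of_mem hT htm]
    rw [e]
    exact ht
  · have hA0 : Measurable (A (AffHol.expFun (AffHol.hS S u))) := by
      rw [(hR u hu).2]
      exact (Complex.measurable_exp.comp (AffHol.measurable_hS_of_mem hu.1)).mul
        (AffHol.measurable_hS_of_mem (hR u hu).1)
    have hm0 := hmart 0 h0m
    rw [hψ0] at hm0
    rw [AffHol.lintegral_leb hT] at h0
    exact c2 _ hA0 h0 fun t ht => hm0.integral_eq_zero hT ht
  · refine c3 (lt_of_eq_of_lt (lintegral_congr_ae ?_) h1)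
    filter_upwards [hkA] with s hs
    rw [hs]
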